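/- Let $A\in\mathbb{R}^{n\times n}$, $B\in\mathbb{R}^{n\times m}$, $K\in\mathbb{R}^{m\times n}$ and let $\overline h\ge 1$ be an integer. Call a sequence of integers $(t_k)_{k\ge 0}$ admissible if $t_0=0$ and $1\le t_{k+1}-t_k\le\overline h$ for all $k\ge0$. For such a sequence put $\tau(t)=t-t_k$ for $t_k\le t\le t_{k+1}-1$, define the delay operator by $(\Delta y)(t)=\sum_{i=t-\tau(t)}^{t-1}y(i)$, and consider the interconnection, for $t=0,1,2,\dots$, $$x(t+1)=(A+BK)x(t)+BK\,e(t),\qquad y(t)=(I-A-BK)x(t)-BK\,e(t),\qquad e(t)=(\Delta y)(t).$$ Let $E_{\overline h}\in\mathbb{R}^{\overline h\times\overline h}$ be the matrix with entries $\min(i,j)$, $0\le i,j\le\overline h-1$, let $\lambda_{\max}(E_{\overline h})$ be its largest eigenvalue, and let $$G(z)=(I-A-BK)\bigl(zI-(A+BK)\bigr)^{-1}BK-BK.$$ Suppose that $A+BK$ is Schur (all its complex eigenvalues have modulus less than $1$) and that there are real symmetric matrices $\mathcal{X}\succ0$ and $\mathcal{Y}\succeq0$ in $\mathbb{R}^{n\times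 n}$ such that $$\begin{bmatrix}G(e^{j\omega})\\ I\end{bmatrix}^{*}\begin{bmatrix}\lambda_{\max}(E_{\overline h})\mathcal{X}+\mathcal{Y}&\mathcal{Y}\\ \mathcal{Y}&-\mathcal{X}\end{bmatrix}\begin{bmatrix}G(e^{j\omega})\\ I\end{bmatrix}\prec0\qquad\text{for all }|\omega|\le\pi .$$ Then the origin of the interconnection is asymptotically stable under arbitrary admissible sampling: for every $\varepsilon>0$ there is $\delta>0$ such that, for every admissible $(t_k)$, every trajectory with $\lVert x(0)\rVert_2<\delta$ satisfies $\lVert x(t)\rVert_2<\varepsilon$ for all $t\ge0$; and for every admissible $(t_k)$ and every initial state $x(0)\in\mathbb{R}^n$, $x(t)\to0$ as $t\to\infty$. -/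

import Mathlib

open scoped ComplexOrder Matrix

namespace AperiodicSampling

noncomputable section

/-- Admissible sampling instants `t_k = s k`: they start at `0`, and every sampling interval
`t_{k+1} - t_k` lies between `1` and `h`. -/
def IsSampling (h : ℕ) (s : ℕ → ℕ) : Prop :=
  s 0 = 0 ∧ ∀ k, s k + 1 ≤ s (k + 1) ∧ s (k + 1) ≤ s k + h

/-- The delay `τ(t) = t - t_k`, where `t_k` is the last sampling instant with `t_k ≤ t`
(for admissible instants `k ≤ t_k`, so that `k` ranges over `0, …, t`). -/
def delay (s : ℕ → ℕ) (t : ℕ) : ℕ :=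
  t - s (Nat.findGreatest (fun k => s k ≤ t) t)

/-- On `[t_k, t_{k+1} - 1]` the delay is `t - t_k`. -/
theorem delay_eq {h : ℕ} {s : ℕ → ℕ} (hs : IsSampling h s) {k t : ℕ}
    (h₁ : s k ≤ t) (h₂ : t < s (k + 1)) : delay s t = t - s k := by
  have hmono : StrictMono s := strictMono_nat_of_lt_succ fun i => (hs.2 i).1
  have hk : Nat.findGreatest (fun k => s k ≤ t) t = k := by
    rw [Nat.findGreatest_eq_iff]
    refine ⟨(hmono.id_le k).trans h₁, fun _ => h₁, fun i hi _ hle => ?_⟩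
    have : s (k + 1) ≤ s i := hmono.monotone hi
    omega
  rw [delay, hk]

/-- The delay operator `(Δ y)(t) = ∑_{i = t - τ(t)}^{t - 1} y(i)`. -/
def delayOp {n : ℕ} (s : ℕ → ℕ) (y : ℕ → Fin n → ℝ) (t : ℕ) : Fin n → ℝ :=
  ∑ i ∈ Finset.Ico (t - delay s t) t, y i

/-- `(x, y, e)` is a trajectory of the feedback interconnection of the linear system
`x(t+1) = (A + B K) x(t) + B K e(t)`, `y(t) = (I - A - B K) x(t) - B K e(t)`
with the delay operator `e = Δ y` belonging to the sampling instants `s`. -/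
structure IsTrajectory {n m : ℕ} (A : Matrix (Fin n) (Fin n) ℝ) (B : Matrix (Fin n) (Fin m) ℝ)
    (K : Matrix (Fin m) (Fin n) ℝ) (s : ℕ → ℕ) (x y e : ℕ → Fin n → ℝ) : Prop where
  state : ∀ t, x (t + 1) = (A + B * K) *ᵥ x t + (B * K) *ᵥ e t
  output : ∀ t, y t = (1 - A - B * K) *ᵥ x t - (B * K) *ᵥ e t
  feedback : ∀ t, e t = delayOp s y t

/-- Euclidean norm of a vector. -/
def norm2 {n : ℕ} (v : Fin n → ℝ) : ℝ := ‖WithLp.toLp 2 v‖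

/-- The origin of the interconnection is asymptotically stable, the sampling instants being
arbitrary with intervals in `[1, h]`: it is stable (with `δ` independent of the sampling
instants), and every trajectory converges to it. -/
def AsymptoticallyStable {n m : ℕ} (A : Matrix (Fin n) (Fin n) ℝ) (B : Matrix (Fin n) (Fin m) ℝ)
    (K : Matrix (Fin m) (Fin n) ℝ) (h : ℕ) : Prop :=
  (∀ ε : ℝ, 0 < ε → ∃ δ : ℝ, 0 < δ ∧ ∀ s, IsSampling h s →
    ∀ x y e, IsTrajectory A B K s x y e →
    norm2 (x 0) < δ → ∀ t, norm2 (x t) < ε) ∧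
  (∀ s, IsSampling h s →
    ∀ x y e, IsTrajectory A B K s x y e →
    Filter.Tendsto (fun t => norm2 (x t)) Filter.atTop (nhds 0))

/-- The `h × h` matrix whose entry in row `i` and column `j` is `min i j`,
`i, j = 0, …, h - 1`. -/
def matE (h : ℕ) : Matrix (Fin h) (Fin h) ℝ :=
  Matrix.of fun i j => ((min i.val j.val : ℕ) : ℝ)

/-- The largest (real) eigenvalue. -/
def lambdaMax {ι : Type*} [Fintype ι] [DecidableEq ι] (M : Matrix ι ι ℝ) : ℝ :=
  sSup (spectrum ℝ M)

/-- For `h ≥ 1` the supremum defining `lambdaMax (matE h)` is attained. -/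
theorem isGreatest_lambdaMax_matE {h : ℕ} (hh : 1 ≤ h) :
    IsGreatest (spectrum ℝ (matE h)) (lambdaMax (matE h)) := by
  have hE : (matE h).IsHermitian := by
    ext i j
    simp [matE, Matrix.conjTranspose_apply, min_comm]
  have : Nonempty (Fin h) := ⟨⟨0, hh⟩⟩
  have hr := hE.spectrum_real_eq_range_eigenvalues
  have hfin : (spectrum ℝ (matE h)).Finite := hr ▸ Set.finite_range _
  have hne : (spectrum ℝ (matE h)).Nonempty := hr ▸ Set.range_nonempty _
  exact ⟨hne.csSup_mem hfin, fun _ hx => le_csSup hfin.bddAbove hx⟩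

/-- Entrywise embedding of real matrices into complex matrices. -/
abbrev toC {ι κ : Type*} (M : Matrix ι κ ℝ) : Matrix ι κ ℂ := M.map Complex.ofReal

/-- A real square matrix is Schur if all its complex eigenvalues have modulus less than `1`. -/
def IsSchur {n : ℕ} (M : Matrix (Fin n) (Fin n) ℝ) : Prop :=
  ∀ μ ∈ spectrum ℂ (toC M), ‖μ‖ < 1

/-- The transfer function `G(z) = (I - A - B K) (z I - (A + B K))⁻¹ B K - B K`. -/
def transferG {n m : ℕ} (A : Matrix (Fin n) (Fin n) ℝ) (B : Matrix (Fin n) (Fin m) ℝ)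
    (K : Matrix (Fin m) (Fin n) ℝ) (z : ℂ) : Matrix (Fin n) (Fin n) ℂ :=
  toC (1 - A - B * K) * (z • (1 : Matrix (Fin n) (Fin n) ℂ) - toC (A + B * K))⁻¹ * toC (B * K)
    - toC (B * K)

/-- The stacked matrix `[G(z); I]`. -/
def stackG {n m : ℕ} (A : Matrix (Fin n) (Fin n) ℝ) (B : Matrix (Fin n) (Fin m) ℝ)
    (K : Matrix (Fin m) (Fin n) ℝ) (z : ℂ) : Matrix (Fin n ⊕ Fin n) (Fin n) ℂ :=
  Matrix.fromRows (transferG A B K z) (1 : Matrix (Fin n) (Fin n) ℂ)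

/-- The multiplier `Π = [[λ_max(E_h) X + Y, Y], [Y, -X]]`. -/
def multiplier {n : ℕ} (h : ℕ) (X Y : Matrix (Fin n) (Fin n) ℝ) :
    Matrix (Fin n ⊕ Fin n) (Fin n ⊕ Fin n) ℝ :=
  Matrix.fromBlocks (lambdaMax (matE h) • X + Y) Y Y (-X)

/-- A complex matrix is negative definite (in particular Hermitian). -/
def NegDef {ι : Type*} [Fintype ι] (M : Matrix ι ι ℂ) : Prop := (-M).PosDef

end

end AperiodicSampling

namespace AperiodicSampling

/-! ### The supply rate of the delay operator -/

/-- The quadratic form of the multiplier `[[P, Y], [Y, -X]]` at `(y, e)`. -/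
noncomputable def supply {n : ℕ} (P X Y : Matrix (Fin n) (Fin n) ℝ) (y e : Fin n → ℝ) : ℝ :=
  y ⬝ᵥ P *ᵥ y + y ⬝ᵥ Y *ᵥ e + e ⬝ᵥ Y *ᵥ y - e ⬝ᵥ X *ᵥ e

theorem matE_isHermitian (h : ℕ) : (matE h).IsHermitian := by
  ext i j
  simp [matE, Matrix.conjTranspose_apply, min_comm]

theorem dotProduct_matE_mulVec_le {h : ℕ} (hh : 1 ≤ h) (v : Fin h → ℝ) :
    v ⬝ᵥ matE h *ᵥ v ≤ lambdaMax (matE h) * (v ⬝ᵥ v) := by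
  have hg := isGreatest_lambdaMax_matE hh
  have hps : (algebraMap ℝ (Matrix (Fin h) (Fin h) ℝ) (lambdaMax (matE h)) - matE h).PosSemidef := by
    rw [Matrix.posSemidef_iff_isHermitian_and_spectrum_nonneg]
    constructor
    · refine Matrix.IsHermitian.sub ?_ (matE_isHermitian h)
      rw [Algebra.algebraMap_eq_smul_one]
      simp [Matrix.IsHermitian]
    · rw [← spectrum.singleton_sub_eq]
      rintro x ⟨a, ha, b, hb, rfl⟩
      rw [Set.mem_singleton_iff.1 ha]
      exact sub_nonneg.2 (hg.2 hb)
  have := hps.dotProduct_mulVec_nonneg v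
  rw [Algebra.algebraMap_eq_smul_one, Matrix.sub_mulVec, dotProduct_sub, Matrix.smul_mulVec,
    Matrix.one_mulVec, dotProduct_smul, star_trivial, smul_eq_mul] at this
  linarith

theorem lambdaMax_matE_nonneg {h : ℕ} (hh : 1 ≤ h) : 0 ≤ lambdaMax (matE h) := by
  have := dotProduct_matE_mulVec_le hh (Pi.single ⟨0, hh⟩ 1)
  simpa [matE] using this

theorem sum_sq_sum_ge_eq_dotProduct_matE (h : ℕ) (v : Fin h → ℝ) :
    v ⬝ᵥ matE h *ᵥ v =
      ∑ l ∈ Finset.range h, (∑ p : Fin h, if l + 1 ≤ p.val then v p else 0) ^ 2 := by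
  have hmin : ∀ p q : Fin h, (((min p.val q.val : ℕ) : ℝ)) =
      ∑ l ∈ Finset.range h, if l + 1 ≤ p.val ∧ l + 1 ≤ q.val then (1 : ℝ) else 0 := by
    intro p q
    rw [Finset.sum_boole]
    have : {l ∈ Finset.range h | l + 1 ≤ p.val ∧ l + 1 ≤ q.val}
        = Finset.range (min p.val q.val) := by
      ext l
      simp only [Finset.mem_filter, Finset.mem_range]
      omega
    rw [this, Finset.card_range]
  simp_rw [sq, Finset.sum_mul_sum, dotProduct, Matrix.mulVec, dotProduct]
  rw [Finset.sum_comm]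
  refine Finset.sum_congr rfl fun p _ => ?_
  rw [Finset.mul_sum, Finset.sum_comm]
  refine Finset.sum_congr rfl fun q _ => ?_
  rw [matE, Matrix.of_apply, hmin, Finset.sum_mul, Finset.mul_sum]
  refine Finset.sum_congr rfl fun l _ => ?_
  by_cases h₁ : l + 1 ≤ p.val <;> by_cases h₂ : l + 1 ≤ q.val <;> simp [h₁, h₂]

/-- The scalar gain bound of the summation operator over at most `h` steps. -/
theorem sum_sq_partial_sums_le {h : ℕ} (hh : 1 ≤ h) {L : ℕ} (hL : L ≤ h) (a : ℕ → ℝ) :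
    ∑ j ∈ Finset.range L, (∑ i ∈ Finset.range j, a i) ^ 2
      ≤ lambdaMax (matE h) * ∑ j ∈ Finset.range L, a j ^ 2 := by
  set b : ℕ → ℝ := fun i => if i < L then a i else 0 with hb
  have h₁ : ∑ j ∈ Finset.range L, (∑ i ∈ Finset.range j, a i) ^ 2
      ≤ ∑ j ∈ Finset.range h, (∑ i ∈ Finset.range j, b i) ^ 2 := by
    refine le_trans (le_of_eq ?_) (Finset.sum_le_sum_of_subset_of_nonneg
      (Finset.range_subset_range.2 hL) fun _ _ _ => sq_nonneg _)
    refine Finset.sum_congr rfl fun j hj => ?_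
    congr 1
    refine Finset.sum_congr rfl fun i hi => ?_
    simp only [Finset.mem_range] at hi hj
    simp [hb, hi.trans hj]
  have h₂ : ∑ j ∈ Finset.range L, a j ^ 2 = ∑ j ∈ Finset.range h, b j ^ 2 := by
    rw [← Finset.sum_subset (Finset.range_subset_range.2 hL)]
    · refine Finset.sum_congr rfl fun j hj => ?_
      simp only [Finset.mem_range] at hj
      simp [hb, hj]
    · intro j _ hj
      simp only [Finset.mem_range] at hj
      simp [hb, hj]
  have h₃ := dotProduct_matE_mulVec_le hh fun p : Fin h => b (h - 1 - p)
  rw [sum_sq_sum_ge_eq_dotProduct_matE] at h₃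
  have h₄ : (fun p : Fin h => b (h - 1 - p)) ⬝ᵥ (fun p : Fin h => b (h - 1 - p))
      = ∑ j ∈ Finset.range h, b j ^ 2 := by
    rw [← Finset.sum_range_reflect, dotProduct,
      Fin.sum_univ_eq_sum_range (fun p => b (h - 1 - p) * b (h - 1 - p))]
    simp only [sq]
  have h₅ : ∀ l ∈ Finset.range h, (∑ p : Fin h, if l + 1 ≤ p.val then b (h - 1 - p) else 0)
      = ∑ i ∈ Finset.range (h - 1 - l), b i := by
    intro l hl
    simp only [Finset.mem_range] at hl
    rw [Fin.sum_univ_eq_sum_range (fun p => if l + 1 ≤ p then b (h - 1 - p) else 0),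
      ← Finset.sum_range_reflect, ← Finset.sum_subset
        (Finset.range_subset_range.2 (show h - 1 - l ≤ h by omega))]
    · refine Finset.sum_congr rfl fun i hi => ?_
      simp only [Finset.mem_range] at hi
      rw [if_pos (by omega)]
      congr 1
      omega
    · intro i hi hi'
      simp only [Finset.mem_range] at hi hi'
      rw [if_neg (by omega)]
  rw [h₄, Finset.sum_congr rfl fun l hl => by rw [h₅ l hl],
    Finset.sum_range_reflect (fun j => (∑ i ∈ Finset.range j, b i) ^ 2)] at h₃
  rw [h₂]
  exact h₁.trans h₃

open scoped MatrixOrder in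
/-- The gain bound of the summation operator, weighted by a positive semidefinite matrix. -/
theorem sum_quadForm_partial_sums_le {n h : ℕ} (hh : 1 ≤ h) {L : ℕ} (hL : L ≤ h)
    {X : Matrix (Fin n) (Fin n) ℝ} (hX : X.PosSemidef) (y : ℕ → Fin n → ℝ) :
    ∑ j ∈ Finset.range L, (∑ i ∈ Finset.range j, y i) ⬝ᵥ X *ᵥ (∑ i ∈ Finset.range j, y i)
      ≤ lambdaMax (matE h) * ∑ j ∈ Finset.range L, y j ⬝ᵥ X *ᵥ y j := by
  obtain ⟨S, hS⟩ := CStarAlgebra.nonneg_iff_eq_star_mul_self.1 hX.nonneg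
  have hq : ∀ v : Fin n → ℝ, v ⬝ᵥ X *ᵥ v = ∑ r, (S *ᵥ v) r ^ 2 := by
    intro v
    rw [hS, ← Matrix.mulVec_mulVec, Matrix.dotProduct_mulVec, Matrix.star_eq_conjTranspose,
      Matrix.vecMul_conjTranspose]
    simp [dotProduct, sq]
  simp only [hq]
  rw [Finset.sum_comm, Finset.sum_comm (s := Finset.range L), Finset.mul_sum]
  refine Finset.sum_le_sum fun r _ => ?_
  simpa [Matrix.mulVec_sum, Finset.sum_apply] using
    sum_sq_partial_sums_le hh hL fun i => (S *ᵥ y i) r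

/-- Partial sums of the supply rate of the summation operator are nonnegative. -/
theorem sum_supply_partial_sums_nonneg {n h : ℕ} (hh : 1 ≤ h) {L : ℕ} (hL : L ≤ h)
    {X Y : Matrix (Fin n) (Fin n) ℝ} (hX : X.PosSemidef) (hY : Y.PosSemidef)
    (y : ℕ → Fin n → ℝ) :
    0 ≤ ∑ j ∈ Finset.range L,
      supply (lambdaMax (matE h) • X + Y) X Y (y j) (∑ i ∈ Finset.range j, y i) := by
  have h₁ := sum_quadForm_partial_sums_le hh hL hX y
  set S : ℕ → Fin n → ℝ := fun j => ∑ i ∈ Finset.range j, y i with hS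
  have h₂ : ∀ j, supply (lambdaMax (matE h) • X + Y) X Y (y j) (S j)
      = (lambdaMax (matE h) * (y j ⬝ᵥ X *ᵥ y j) - S j ⬝ᵥ X *ᵥ S j)
        + (S (j + 1) ⬝ᵥ Y *ᵥ S (j + 1) - S j ⬝ᵥ Y *ᵥ S j) := by
    intro j
    have : S (j + 1) = S j + y j := Finset.sum_range_succ _ _
    rw [this]
    simp only [supply, Matrix.add_mulVec, Matrix.mulVec_add, dotProduct_add, add_dotProduct,
      Matrix.smul_mulVec, dotProduct_smul, smul_eq_mul]
    ring
  change 0 ≤ ∑ j ∈ Finset.range L, supply (lambdaMax (matE h) • X + Y) X Y (y j) (S j)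
  rw [Finset.sum_congr rfl fun j _ => h₂ j, Finset.sum_add_distrib, Finset.sum_sub_distrib,
    ← Finset.mul_sum, Finset.sum_range_sub (fun j => S j ⬝ᵥ Y *ᵥ S j)]
  have h₃ : 0 ≤ S L ⬝ᵥ Y *ᵥ S L := by simpa using hY.dotProduct_mulVec_nonneg (S L)
  have h₄ : S 0 = 0 := rfl
  rw [h₄]
  simp only [zero_dotProduct, sub_zero]
  linarith

theorem IsSampling.exists_mem_interval {h : ℕ} {s : ℕ → ℕ} (hs : IsSampling h s) (t : ℕ) :
    ∃ k, s k ≤ t ∧ t < s (k + 1) := by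
  induction t with
  | zero => exact ⟨0, hs.1.le, Nat.succ_le_iff.1 ((Nat.le_add_left 1 _).trans (hs.2 0).1)⟩
  | succ t ih =>
    obtain ⟨k, h₁, h₂⟩ := ih
    rcases Nat.lt_or_ge (t + 1) (s (k + 1)) with h₃ | h₃
    · exact ⟨k, by omega, h₃⟩
    · have := (hs.2 (k + 1)).1
      exact ⟨k + 1, h₃, by omega⟩

/-- Sums that are nonnegative over initial parts of all sampling intervals are nonnegative. -/
theorem IsSampling.sum_nonneg {h : ℕ} {s : ℕ → ℕ} (hs : IsSampling h s) (φ : ℕ → ℝ)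
    (hφ : ∀ k L, s k + L ≤ s (k + 1) → 0 ≤ ∑ j ∈ Finset.range L, φ (s k + j)) (T : ℕ) :
    0 ≤ ∑ t ∈ Finset.range T, φ t := by
  have hk : ∀ k, 0 ≤ ∑ t ∈ Finset.range (s k), φ t := by
    intro k
    induction k with
    | zero => simp [hs.1]
    | succ k ih =>
      have hle := (hs.2 k).1
      obtain ⟨L, hL⟩ := Nat.exists_eq_add_of_le (show s k ≤ s (k + 1) by omega)
      rw [hL, Finset.sum_range_add]
      exact add_nonneg ih (hφ k L hL.ge)
  obtain ⟨k, h₁, h₂⟩ := hs.exists_mem_interval T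
  obtain ⟨L, rfl⟩ := Nat.exists_eq_add_of_le h₁
  rw [Finset.sum_range_add]
  exact add_nonneg (hk k) (hφ k L h₂.le)

theorem delayOp_eq_sum {n h : ℕ} {s : ℕ → ℕ} (hs : IsSampling h s) (y : ℕ → Fin n → ℝ) {k j : ℕ}
    (hj : s k + j < s (k + 1)) :
    delayOp s y (s k + j) = ∑ i ∈ Finset.range j, y (s k + i) := by
  rw [delayOp, delay_eq hs (Nat.le_add_right _ _) hj, Nat.add_sub_cancel_left,
    Nat.add_sub_cancel, Finset.sum_Ico_eq_sum_range, Nat.add_sub_cancel_left]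

/-- The delay operator satisfies the quadratic constraint over every finite horizon. -/
theorem sum_supply_delayOp_nonneg {n h : ℕ} (hh : 1 ≤ h) {s : ℕ → ℕ} (hs : IsSampling h s)
    {X Y : Matrix (Fin n) (Fin n) ℝ} (hX : X.PosSemidef) (hY : Y.PosSemidef)
    (y : ℕ → Fin n → ℝ) (T : ℕ) :
    0 ≤ ∑ t ∈ Finset.range T,
      supply (lambdaMax (matE h) • X + Y) X Y (y t) (delayOp s y t) := by
  refine hs.sum_nonneg _ (fun k L hL => ?_) T
  have hLh : L ≤ h := by have := (hs.2 k).2; omega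
  refine (sum_supply_partial_sums_nonneg hh hLh hX hY fun i => y (s k + i)).trans_eq ?_
  refine Finset.sum_congr rfl fun j hj => ?_
  rw [delayOp_eq_sum hs y (by have := Finset.mem_range.1 hj; omega)]

/-! ### The discrete Fourier transform over a finite horizon -/

/-- The discrete Fourier transform at `w` of the first `N` terms of a real vector sequence. -/
noncomputable def dft {n : ℕ} (N : ℕ) (w : ℂ) (u : ℕ → Fin n → ℝ) : Fin n → ℂ :=
  fun i => ∑ t ∈ Finset.range N, w⁻¹ ^ t * (u t i : ℂ)

theorem dft_shift {n N : ℕ} {w : ℂ} (hw : w ^ N = 1) (hw₀ : w ≠ 0) (u : ℕ → Fin n → ℝ) :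
    dft N w (fun t => u (t + 1)) = w • (dft N w u - fun i => ((u 0 i - u N i : ℝ) : ℂ)) := by
  ext i
  simp only [dft, Pi.smul_apply, Pi.sub_apply, smul_eq_mul]
  have h₁ := Finset.sum_range_succ (fun t => w⁻¹ ^ t * (u t i : ℂ)) N
  rw [Finset.sum_range_succ'] at h₁
  have h₂ : ∑ t ∈ Finset.range N, w⁻¹ ^ t * (u (t + 1) i : ℂ)
      = w * ∑ t ∈ Finset.range N, w⁻¹ ^ (t + 1) * (u (t + 1) i : ℂ) := by
    rw [Finset.mul_sum]
    refine Finset.sum_congr rfl fun t _ => ?_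
    rw [pow_succ]
    field_simp
  rw [h₂]
  simp only [inv_pow, hw, pow_zero, inv_one, one_mul] at h₁ ⊢
  push_cast
  linear_combination w * h₁

theorem dft_mulVec {n N : ℕ} (w : ℂ) (M : Matrix (Fin n) (Fin n) ℝ) (u : ℕ → Fin n → ℝ) :
    dft N w (fun t => M *ᵥ u t) = toC M *ᵥ dft N w u := by
  ext i
  simp only [dft, Matrix.mulVec, dotProduct, Matrix.map_apply, Complex.ofReal_sum,
    Complex.ofReal_mul, Finset.mul_sum]
  rw [Finset.sum_comm]
  refine Finset.sum_congr rfl fun j _ => Finset.sum_congr rfl fun t _ => by ring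

theorem dft_add {n N : ℕ} (w : ℂ) (u v : ℕ → Fin n → ℝ) :
    dft N w (fun t => u t + v t) = dft N w u + dft N w v := by
  ext i
  simp [dft, mul_add, Finset.sum_add_distrib]

theorem dft_sub {n N : ℕ} (w : ℂ) (u v : ℕ → Fin n → ℝ) :
    dft N w (fun t => u t - v t) = dft N w u - dft N w v := by
  ext i
  simp [dft, mul_sub, Finset.sum_sub_distrib]

theorem sum_pow_mul_inv_pow {N : ℕ} {ζ : ℂ} (hζ : IsPrimitiveRoot ζ N) {t s : ℕ} (ht : t < N)
    (hs : s < N) :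
    ∑ k ∈ Finset.range N, (ζ ^ t * ζ⁻¹ ^ s) ^ k = if t = s then (N : ℂ) else 0 := by
  have hζ₀ : ζ ≠ 0 := hζ.ne_zero (by omega)
  split_ifs with hts
  · subst hts
    simp [mul_inv_cancel₀ (pow_ne_zero t hζ₀)]
  · have hne : ζ ^ t * ζ⁻¹ ^ s ≠ 1 := by
      intro hc
      apply hts
      apply hζ.pow_inj ht hs
      rw [inv_pow] at hc
      exact (mul_inv_eq_one₀ (pow_ne_zero _ hζ₀)).1 hc
    have hp : (ζ ^ t * ζ⁻¹ ^ s) ^ N = 1 := by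
      rw [mul_pow, ← pow_mul, ← pow_mul, mul_comm t, mul_comm s, pow_mul, pow_mul, inv_pow,
        hζ.pow_eq_one]
      simp
    rw [geom_sum_eq hne, hp, sub_self, zero_div]

theorem sum_star_dft_mul_dft {n N : ℕ} {ζ : ℂ} (hζ : IsPrimitiveRoot ζ N) (hN : N ≠ 0)
    (u v : ℕ → Fin n → ℝ) (i j : Fin n) :
    ∑ k ∈ Finset.range N, star (dft N (ζ ^ k) u i) * dft N (ζ ^ k) v j
      = N * ∑ t ∈ Finset.range N, ((u t i * v t j : ℝ) : ℂ) := by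
  have hconj : star ζ = ζ⁻¹ := by
    have : ‖ζ‖ = 1 := hζ.norm'_eq_one hN
    rw [Complex.inv_eq_conj this]
    rfl
  have h₁ : ∀ k, star (dft N (ζ ^ k) u i) * dft N (ζ ^ k) v j
      = ∑ t ∈ Finset.range N, ∑ s ∈ Finset.range N,
        (u t i : ℂ) * (v s j : ℂ) * (ζ ^ t * ζ⁻¹ ^ s) ^ k := by
    intro k
    simp only [dft, star_sum, Finset.sum_mul_sum, star_mul', star_pow, star_inv₀, hconj]
    refine Finset.sum_congr rfl fun t _ => Finset.sum_congr rfl fun s _ => ?_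
    have : star (u t i : ℂ) = u t i := Complex.conj_ofReal _
    have h₂ : ((ζ⁻¹ ^ k)⁻¹) ^ t = (ζ ^ t) ^ k := by
      rw [inv_pow ζ, inv_inv, ← pow_mul, ← pow_mul, mul_comm]
    have h₃ : ((ζ ^ k)⁻¹) ^ s = (ζ⁻¹ ^ s) ^ k := by
      rw [← inv_pow, ← pow_mul, ← pow_mul, mul_comm]
    rw [this, mul_pow, h₂, h₃]
    ring
  simp only [h₁]
  rw [Finset.sum_comm, Finset.mul_sum]
  refine Finset.sum_congr rfl fun t ht => ?_
  rw [Finset.sum_comm]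
  simp only [← Finset.mul_sum]
  rw [Finset.sum_congr rfl fun s hs => by
    rw [sum_pow_mul_inv_pow hζ (Finset.mem_range.1 ht) (Finset.mem_range.1 hs)]]
  simp only [mul_ite, mul_zero, Finset.sum_ite_eq, ht, if_true]
  push_cast
  ring

/-- Parseval's identity for bilinear forms. -/
theorem sum_form_dft {n N : ℕ} {ζ : ℂ} (hζ : IsPrimitiveRoot ζ N) (hN : N ≠ 0)
    (P : Matrix (Fin n) (Fin n) ℝ) (u v : ℕ → Fin n → ℝ) :
    ∑ k ∈ Finset.range N, (star (dft N (ζ ^ k) u) ⬝ᵥ toC P *ᵥ dft N (ζ ^ k) v).re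
      = N * ∑ t ∈ Finset.range N, u t ⬝ᵥ P *ᵥ v t := by
  have h : ∑ k ∈ Finset.range N, star (dft N (ζ ^ k) u) ⬝ᵥ toC P *ᵥ dft N (ζ ^ k) v
      = ((N * ∑ t ∈ Finset.range N, u t ⬝ᵥ P *ᵥ v t : ℝ) : ℂ) := by
    have h₁ : ∀ k, star (dft N (ζ ^ k) u) ⬝ᵥ toC P *ᵥ dft N (ζ ^ k) v
        = ∑ i, ∑ j, (P i j : ℂ) * (star (dft N (ζ ^ k) u i) * dft N (ζ ^ k) v j) := by
      intro k
      simp only [dotProduct, Matrix.mulVec, Matrix.map_apply, Finset.mul_sum, Pi.star_apply]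
      refine Finset.sum_congr rfl fun i _ => Finset.sum_congr rfl fun j _ => by ring
    simp only [h₁]
    rw [Finset.sum_comm]
    simp_rw [Finset.sum_comm (s := Finset.range N), ← Finset.mul_sum,
      sum_star_dft_mul_dft hζ hN]
    simp only [dotProduct, Matrix.mulVec]
    push_cast
    simp only [Finset.mul_sum]
    rw [Finset.sum_comm' (s := Finset.range N) (t := fun _ => Finset.univ)
      (s' := fun _ => Finset.range N) (t' := Finset.univ) (by simp [and_comm])]
    refine Finset.sum_congr rfl fun i _ => ?_
    rw [Finset.sum_comm]
    refine Finset.sum_congr rfl fun t _ => Finset.sum_congr rfl fun j _ => by ring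
  rw [← Complex.re_sum, h, Complex.ofReal_re]

/-! ### The frequency domain inequality -/

/-- The Hermitian form of the multiplier `[[P, Y], [Y, -X]]` at `(y, v)`. -/
noncomputable def supplyC {n : ℕ} (P X Y : Matrix (Fin n) (Fin n) ℝ) (y v : Fin n → ℂ) : ℝ :=
  (star y ⬝ᵥ toC P *ᵥ y).re + (star y ⬝ᵥ toC Y *ᵥ v).re + (star v ⬝ᵥ toC Y *ᵥ y).re
    - (star v ⬝ᵥ toC X *ᵥ v).re

/-- The squared Euclidean norm of a complex vector. -/
noncomputable def sqC {n : ℕ} (x : Fin n → ℂ) : ℝ := (star x ⬝ᵥ x).re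

theorem sqC_eq_sum {n : ℕ} (x : Fin n → ℂ) : sqC x = ∑ i, ‖x i‖ ^ 2 := by
  simp [sqC, dotProduct, ← Complex.normSq_eq_norm_sq, Complex.normSq_apply]

theorem sqC_nonneg {n : ℕ} (x : Fin n → ℂ) : 0 ≤ sqC x := by
  rw [sqC_eq_sum]
  positivity

theorem eq_zero_of_sqC_eq_zero {n : ℕ} {x : Fin n → ℂ} (hx : sqC x = 0) : x = 0 := by
  rw [sqC_eq_sum, Finset.sum_eq_zero_iff_of_nonneg fun _ _ => by positivity] at hx
  ext i
  simpa using hx i (Finset.mem_univ i)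

theorem sqC_smul {n : ℕ} (a : ℂ) (x : Fin n → ℂ) : sqC (a • x) = ‖a‖ ^ 2 * sqC x := by
  simp [sqC_eq_sum, mul_pow, Finset.mul_sum]

theorem form_smul {n : ℕ} (P : Matrix (Fin n) (Fin n) ℂ) (r : ℝ) (u v : Fin n → ℂ) :
    (star ((r : ℂ) • u) ⬝ᵥ P *ᵥ ((r : ℂ) • v)).re = r ^ 2 * (star u ⬝ᵥ P *ᵥ v).re := by
  have : star (r : ℂ) = r := Complex.conj_ofReal r
  rw [star_smul, Matrix.mulVec_smul, smul_dotProduct, dotProduct_smul, this, smul_smul,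
    smul_eq_mul, ← Complex.ofReal_mul, Complex.re_ofReal_mul, sq]

theorem supplyC_smul {n : ℕ} (P X Y : Matrix (Fin n) (Fin n) ℝ) (r : ℝ) (y v : Fin n → ℂ) :
    supplyC P X Y ((r : ℂ) • y) ((r : ℂ) • v) = r ^ 2 * supplyC P X Y y v := by
  simp only [supplyC, form_smul]
  ring

theorem exists_pos_mul_le_add_mul {α : Type*} [TopologicalSpace α] {S : Set α} (hS : IsCompact S)
    {f g q : α → ℝ} (hf : Continuous f) (hg : Continuous g) (hq : Continuous q)
    (hg₀ : ∀ p, 0 ≤ g p) (hfg : ∀ p ∈ S, g p = 0 → 0 < f p) :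
    ∃ c C : ℝ, 0 < c ∧ 0 ≤ C ∧ ∀ p ∈ S, c * q p ≤ f p + C * g p := by
  obtain ⟨m, hm⟩ := hS.elim_directed_cover (fun m : ℕ => {p | 0 < f p + m * g p})
    (fun m => isOpen_lt continuous_const (by fun_prop)) (by
      intro p hp
      rw [Set.mem_iUnion]
      rcases (hg₀ p).eq_or_lt with h | h
      · exact ⟨0, by simpa using hfg p hp h.symm⟩
      · obtain ⟨m, hm⟩ := exists_nat_gt (-f p / g p)
        rw [div_lt_iff₀ h] at hm
        exact ⟨m, by simp only [Set.mem_ofPred_eq]; linarith⟩)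
    (directed_of_isDirected_le fun a b hab p hp => by
      have : (a : ℝ) * g p ≤ b * g p := by gcongr; exact hg₀ p
      simp only [Set.mem_ofPred_eq] at hp ⊢
      linarith)
  obtain ⟨b, hb⟩ := hS.bddAbove_image (f := fun p => q p / (f p + m * g p))
    (hq.continuousOn.div (by fun_prop) fun p hp => (hm hp).ne')
  have hb' : 0 < max b 1 := lt_max_of_lt_right one_pos
  refine ⟨(max b 1)⁻¹, m, inv_pos.2 hb', m.cast_nonneg, fun p hp => ?_⟩
  have hpos : 0 < f p + m * g p := hm hp
  rw [inv_mul_le_iff₀ hb', ← div_le_iff₀ hpos]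
  exact (hb (Set.mem_image_of_mem _ hp)).trans (le_max_left _ _)

theorem IsSchur.isUnit {n : ℕ} {M : Matrix (Fin n) (Fin n) ℝ} (hM : IsSchur M) {z : ℂ}
    (hz : ‖z‖ = 1) : IsUnit (z • (1 : Matrix (Fin n) (Fin n) ℂ) - toC M) := by
  by_contra h
  refine (hM z ?_).ne hz
  rwa [spectrum.mem_iff, Algebra.algebraMap_eq_smul_one]

theorem supplyC_transferG_neg {n m : ℕ} (A : Matrix (Fin n) (Fin n) ℝ)
    (B : Matrix (Fin n) (Fin m) ℝ) (K : Matrix (Fin m) (Fin n) ℝ) (h : ℕ)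
    (X Y : Matrix (Fin n) (Fin n) ℝ) (z : ℂ)
    (hz : NegDef ((stackG A B K z)ᴴ * toC (multiplier h X Y) * stackG A B K z))
    {v : Fin n → ℂ} (hv : v ≠ 0) :
    supplyC (lambdaMax (matE h) • X + Y) X Y (transferG A B K z *ᵥ v) v < 0 := by
  have h₁ := Matrix.PosDef.dotProduct_mulVec_pos hz hv
  rw [Matrix.neg_mulVec, dotProduct_neg, ← Matrix.mulVec_mulVec, ← Matrix.mulVec_mulVec,
    Matrix.dotProduct_mulVec, Matrix.vecMul_conjTranspose, star_star, stackG,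
    Matrix.fromRows_mulVec, Matrix.one_mulVec, multiplier, toC, Matrix.fromBlocks_map,
    Matrix.fromBlocks_mulVec] at h₁
  have h₂ := (Complex.lt_def.1 h₁).1
  have hst : star (Sum.elim (transferG A B K z *ᵥ v) v)
      = Sum.elim (star (transferG A B K z *ᵥ v)) (star v) := by
    ext i
    rcases i with i | i <;> rfl
  rw [hst] at h₂
  simp only [Sum.elim_comp_inl, Sum.elim_comp_inr, sumElim_dotProduct_sumElim, dotProduct_add,
    Complex.neg_re, Complex.add_re, Complex.zero_re] at h₂
  have h₃ : (-X).map Complex.ofReal = -(X.map Complex.ofReal) := by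
    ext i j
    simp
  rw [h₃, Matrix.neg_mulVec, dotProduct_neg, Complex.neg_re] at h₂
  unfold supplyC
  linarith

theorem exists_supplyC_add_le {n m : ℕ} (A : Matrix (Fin n) (Fin n) ℝ)
    (B : Matrix (Fin n) (Fin m) ℝ) (K : Matrix (Fin m) (Fin n) ℝ) (h : ℕ)
    (hSchur : IsSchur (A + B * K)) (X Y : Matrix (Fin n) (Fin n) ℝ)
    (hfreq : ∀ ω : ℝ, |ω| ≤ Real.pi →
      NegDef ((stackG A B K (Complex.exp (Complex.I * (ω : ℂ))))ᴴ * toC (multiplier h X Y) *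
        stackG A B K (Complex.exp (Complex.I * (ω : ℂ))))) :
    ∃ c C : ℝ, 0 < c ∧ 0 ≤ C ∧ ∀ (z : ℂ) (x v : Fin n → ℂ), ‖z‖ = 1 →
      supplyC (lambdaMax (matE h) • X + Y) X Y
          (toC (1 - A - B * K) *ᵥ x - toC (B * K) *ᵥ v) v + c * sqC x
        ≤ C * sqC (z • x - toC (A + B * K) *ᵥ x - toC (B * K) *ᵥ v) := by
  set P := lambdaMax (matE h) • X + Y
  set f : ℂ × (Fin n → ℂ) × (Fin n → ℂ) → ℝ := fun p =>
    -supplyC P X Y (toC (1 - A - B * K) *ᵥ p.2.1 - toC (B * K) *ᵥ p.2.2) p.2.2 with hf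
  set g : ℂ × (Fin n → ℂ) × (Fin n → ℂ) → ℝ := fun p =>
    sqC (p.1 • p.2.1 - toC (A + B * K) *ᵥ p.2.1 - toC (B * K) *ᵥ p.2.2) with hg
  obtain ⟨c, C, hc, hC, hcC⟩ := exists_pos_mul_le_add_mul
    ((isCompact_sphere (0 : ℂ) 1).prod (isCompact_sphere (0 : (Fin n → ℂ) × (Fin n → ℂ)) 1))
    (f := f) (g := g) (q := fun p => sqC p.2.1)
    (by simp only [hf, supplyC]; fun_prop)
    (by simp only [hg, sqC]; fun_prop)
    (by simp only [sqC]; fun_prop)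
    (fun p => sqC_nonneg _) (by
      rintro ⟨z, x, v⟩ ⟨hz, hp⟩ h₀
      simp only [mem_sphere_iff_norm, sub_zero] at hz hp
      have hu := hSchur.isUnit hz
      have h₁ : (z • (1 : Matrix (Fin n) (Fin n) ℂ) - toC (A + B * K)) *ᵥ x
          = toC (B * K) *ᵥ v := by
        have := eq_zero_of_sqC_eq_zero h₀
        rw [Matrix.sub_mulVec, Matrix.smul_mulVec, Matrix.one_mulVec]
        exact sub_eq_zero.1 this
      have h₂ : x = (z • (1 : Matrix (Fin n) (Fin n) ℂ) - toC (A + B * K))⁻¹ *ᵥ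
          (toC (B * K) *ᵥ v) := by
        rw [← h₁, Matrix.mulVec_mulVec, Matrix.nonsing_inv_mul _
          ((Matrix.isUnit_iff_isUnit_det _).1 hu), Matrix.one_mulVec]
      have hv : v ≠ 0 := by
        rintro rfl
        have : x = 0 := by simpa using h₂
        subst this
        simp at hp
      have h₃ : toC (1 - A - B * K) *ᵥ x - toC (B * K) *ᵥ v = transferG A B K z *ᵥ v := by
        rw [transferG, Matrix.sub_mulVec, ← Matrix.mulVec_mulVec, ← Matrix.mulVec_mulVec, ← h₂]
      have hexp : Complex.exp (Complex.I * (z.arg : ℂ)) = z := by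
        have := Complex.norm_mul_exp_arg_mul_I z
        rwa [hz, Complex.ofReal_one, one_mul, mul_comm] at this
      have h₄ := hfreq z.arg (Complex.abs_arg_le_pi z)
      rw [hexp] at h₄
      simp only [hf, h₃]
      exact neg_pos.2 (supplyC_transferG_neg A B K h X Y z h₄ hv))
  refine ⟨c, C, hc, hC, fun z x v hz => ?_⟩
  by_cases hxv : (x, v) = 0
  · obtain ⟨rfl, rfl⟩ := Prod.mk_eq_zero.1 hxv
    simp [supplyC, sqC]
  obtain ⟨r, hr⟩ : ∃ r : ℝ, r = ‖(x, v)‖ := ⟨_, rfl⟩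
  have hr₀ : 0 < r := hr ▸ norm_pos_iff.2 hxv
  have hrC : (r : ℂ) ≠ 0 := by exact_mod_cast hr₀.ne'
  obtain ⟨⟨x', v'⟩, hp⟩ : ∃ p : (Fin n → ℂ) × (Fin n → ℂ), (x, v) = (r : ℂ) • p :=
    ⟨(r : ℂ)⁻¹ • (x, v), by rw [smul_smul, mul_inv_cancel₀ hrC, one_smul]⟩
  have hp' : ‖(x', v')‖ = 1 := by
    have := congrArg norm hp
    rw [norm_smul, ← hr, Complex.norm_real, Real.norm_of_nonneg hr₀.le] at this
    exact (mul_right_injective₀ hr₀.ne' (by simpa using this)).symm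
  have key := hcC (z, x', v') ⟨by simpa using hz, by simpa using hp'⟩
  obtain ⟨rfl, rfl⟩ : x = (r : ℂ) • x' ∧ v = (r : ℂ) • v' := Prod.mk.inj hp
  have h₁ : toC (1 - A - B * K) *ᵥ ((r : ℂ) • x') - toC (B * K) *ᵥ ((r : ℂ) • v')
      = (r : ℂ) • (toC (1 - A - B * K) *ᵥ x' - toC (B * K) *ᵥ v') := by
    simp only [Matrix.mulVec_smul, smul_sub]
  have h₂ : z • ((r : ℂ) • x') - toC (A + B * K) *ᵥ ((r : ℂ) • x')
        - toC (B * K) *ᵥ ((r : ℂ) • v')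
      = (r : ℂ) • (z • x' - toC (A + B * K) *ᵥ x' - toC (B * K) *ᵥ v') := by
    simp only [Matrix.mulVec_smul, smul_sub, smul_comm z]
  have hrn : ‖(r : ℂ)‖ = r := by rw [Complex.norm_real, Real.norm_of_nonneg hr₀.le]
  rw [h₁, h₂, supplyC_smul, sqC_smul, sqC_smul, hrn]
  simp only [hf, hg] at key
  have := mul_le_mul_of_nonneg_left key (sq_nonneg r)
  linarith

/-! ### Summability of trajectories -/

/-- The frequency domain inequality yields dissipation over a finite horizon. -/
theorem sum_supply_add_le {n : ℕ} {M F D P X Y : Matrix (Fin n) (Fin n) ℝ} {c C : ℝ}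
    (hcC : ∀ (z : ℂ) (x v : Fin n → ℂ), ‖z‖ = 1 →
      supplyC P X Y (toC D *ᵥ x - toC F *ᵥ v) v + c * sqC x
        ≤ C * sqC (z • x - toC M *ᵥ x - toC F *ᵥ v))
    {x e : ℕ → Fin n → ℝ} (hx : ∀ t, x (t + 1) = M *ᵥ x t + F *ᵥ e t) {N : ℕ} (hN : N ≠ 0) :
    ∑ t ∈ Finset.range N, supply P X Y (D *ᵥ x t - F *ᵥ e t) (e t)
        + c * ∑ t ∈ Finset.range N, x t ⬝ᵥ x t
      ≤ C * ((x 0 - x N) ⬝ᵥ (x 0 - x N)) := by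
  have hζ := Complex.isPrimitiveRoot_exp N hN
  set ζ := Complex.exp (2 * Real.pi * Complex.I / N)
  set y : ℕ → Fin n → ℝ := fun t => D *ᵥ x t - F *ᵥ e t with hy
  have hnorm : ∀ k, ‖ζ ^ k‖ = 1 := fun k => by rw [norm_pow, hζ.norm'_eq_one hN, one_pow]
  have hsq : ∑ k ∈ Finset.range N, sqC (dft N (ζ ^ k) x)
      = N * ∑ t ∈ Finset.range N, x t ⬝ᵥ x t := by
    simpa [sqC, toC] using sum_form_dft hζ hN 1 x x
  have hsup : ∑ k ∈ Finset.range N, supplyC P X Y (dft N (ζ ^ k) y) (dft N (ζ ^ k) e)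
      = N * ∑ t ∈ Finset.range N, supply P X Y (y t) (e t) := by
    simp only [supplyC, supply, Finset.sum_add_distrib, Finset.sum_sub_distrib,
      sum_form_dft hζ hN]
    ring
  have hk : ∀ k ∈ Finset.range N,
      supplyC P X Y (dft N (ζ ^ k) y) (dft N (ζ ^ k) e) + c * sqC (dft N (ζ ^ k) x)
        ≤ C * ((x 0 - x N) ⬝ᵥ (x 0 - x N)) := by
    intro k _
    have hw₀ : ζ ^ k ≠ 0 := pow_ne_zero _ (hζ.ne_zero hN)
    have hwN : (ζ ^ k) ^ N = 1 := by rw [← pow_mul, mul_comm, pow_mul, hζ.pow_eq_one, one_pow]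
    have h₁ : dft N (ζ ^ k) y
        = toC D *ᵥ dft N (ζ ^ k) x - toC F *ᵥ dft N (ζ ^ k) e := by
      rw [← dft_mulVec, ← dft_mulVec, ← dft_sub]
    have h₂ := dft_shift hwN hw₀ x
    simp only [hx] at h₂
    rw [dft_add, dft_mulVec, dft_mulVec, smul_sub] at h₂
    have h₃ : ζ ^ k • dft N (ζ ^ k) x - toC M *ᵥ dft N (ζ ^ k) x - toC F *ᵥ dft N (ζ ^ k) e
        = ζ ^ k • fun i => ((x 0 i - x N i : ℝ) : ℂ) := by
      rw [sub_sub, h₂]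
      abel
    have h₄ := hcC (ζ ^ k) (dft N (ζ ^ k) x) (dft N (ζ ^ k) e) (hnorm k)
    rw [h₃, sqC_smul, hnorm, ← h₁] at h₄
    refine h₄.trans_eq ?_
    rw [sqC_eq_sum]
    simp [dotProduct, sq, -Complex.ofReal_sub, Complex.norm_real]
  have hsum := Finset.sum_le_sum hk
  rw [Finset.sum_add_distrib, ← Finset.mul_sum, hsq, hsup, Finset.sum_const, Finset.card_range,
    nsmul_eq_mul] at hsum
  have hN' : (0 : ℝ) < N := by positivity
  refine le_of_mul_le_mul_left ?_ hN'
  linarith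

section
attribute [local instance] Matrix.linftyOpNormedRing Matrix.linftyOpNormedAlgebra

theorem IsSchur.tendsto_toC_pow {n : ℕ} {M : Matrix (Fin n) (Fin n) ℝ} (hM : IsSchur M) :
    Filter.Tendsto (fun k : ℕ => toC M ^ k) Filter.atTop (nhds 0) := by
  rcases isEmpty_or_nonempty (Fin n) with hn | hn
  · exact tendsto_const_nhds.congr fun k => Subsingleton.elim _ _
  have hρ : spectralRadius ℂ (toC M) < (1 : NNReal) :=
    spectrum.spectralRadius_lt_of_forall_lt (toC M) fun μ hμ => hM μ hμ
  obtain ⟨r, hr₁, hr₂⟩ := ENNReal.lt_iff_exists_nnreal_btwn.1 hρ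
  have hr : (r : ℝ) < 1 := by exact_mod_cast hr₂
  have hev := (spectrum.pow_nnnorm_pow_one_div_tendsto_nhds_spectralRadius (toC M)).eventually_lt_const
    hr₁
  refine squeeze_zero_norm' ?_ (tendsto_pow_atTop_nhds_zero_of_lt_one r.2 hr)
  filter_upwards [hev, Filter.eventually_gt_atTop 0] with k hk hk₀
  have hk' : (0 : ℝ) < k := by exact_mod_cast hk₀
  rw [one_div, ENNReal.rpow_inv_lt_iff hk', ENNReal.rpow_natCast] at hk
  exact_mod_cast hk.le

end

theorem IsSchur.tendsto_pow_mulVec {n : ℕ} {M : Matrix (Fin n) (Fin n) ℝ} (hM : IsSchur M)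
    (v : Fin n → ℝ) : Filter.Tendsto (fun k : ℕ => M ^ k *ᵥ v) Filter.atTop (nhds 0) := by
  have h₁ : Filter.Tendsto (fun k : ℕ => M ^ k) Filter.atTop (nhds 0) := by
    have hre : Continuous fun Z : Matrix (Fin n) (Fin n) ℂ => Z.map Complex.re :=
      continuous_id.matrix_map Complex.continuous_re
    have h₂ := (hre.tendsto 0).comp hM.tendsto_toC_pow
    have h₃ : ((0 : Matrix (Fin n) (Fin n) ℂ).map Complex.re) = 0 := by
      ext i j
      simp
    rw [h₃] at h₂
    refine h₂.congr fun k => ?_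
    have h₄ : toC M ^ k = toC (M ^ k) :=
      (map_pow (Complex.ofRealHom.mapMatrix (m := Fin n)) M k).symm
    simp only [Function.comp_apply, h₄]
    ext i j
    simp
  have h₂ : Continuous fun Z : Matrix (Fin n) (Fin n) ℝ => Z *ᵥ v := by fun_prop
  simpa [Function.comp_def] using (h₂.tendsto 0).comp h₁

theorem exists_sum_sq_le {n m : ℕ} (A : Matrix (Fin n) (Fin n) ℝ) (B : Matrix (Fin n) (Fin m) ℝ)
    (K : Matrix (Fin m) (Fin n) ℝ) (h : ℕ) (hh : 1 ≤ h) (hSchur : IsSchur (A + B * K))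
    {X Y : Matrix (Fin n) (Fin n) ℝ} (hX : X.PosSemidef) (hY : Y.PosSemidef)
    (hfreq : ∀ ω : ℝ, |ω| ≤ Real.pi →
      NegDef ((stackG A B K (Complex.exp (Complex.I * (ω : ℂ))))ᴴ * toC (multiplier h X Y) *
        stackG A B K (Complex.exp (Complex.I * (ω : ℂ))))) :
    ∃ γ : ℝ, 0 ≤ γ ∧ ∀ s, IsSampling h s → ∀ x y e, IsTrajectory A B K s x y e →
      ∀ T, ∑ t ∈ Finset.range T, x t ⬝ᵥ x t ≤ γ * (x 0 ⬝ᵥ x 0) := by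
  obtain ⟨c, C, hc, hC, hcC⟩ := exists_supplyC_add_le A B K h hSchur X Y hfreq
  refine ⟨C / c, by positivity, fun s hs x y e htr T => ?_⟩
  set M := A + B * K
  set F := B * K
  set P := lambdaMax (matE h) • X + Y
  have hP : P.PosSemidef := (hX.smul (lambdaMax_matE_nonneg hh)).add hY
  -- the trajectory with input switched off from time `T` on
  set e' : ℕ → Fin n → ℝ := fun t => if t < T then e t else 0 with he'
  set x' : ℕ → Fin n → ℝ := fun t => if t < T then x t else M ^ (t - T) *ᵥ x T with hx'
  have hx'T : ∀ t ≤ T, x' t = x t := by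
    intro t ht
    rcases ht.lt_or_eq with h | rfl
    · simp [hx', h]
    · simp [hx']
  have hrec : ∀ t, x' (t + 1) = M *ᵥ x' t + F *ᵥ e' t := by
    intro t
    rcases Nat.lt_or_ge t T with ht | ht
    · rw [hx'T _ ht, hx'T _ ht.le]
      simp only [he', if_pos ht]
      exact htr.state t
    · have h₁ : t + 1 - T = (t - T) + 1 := by omega
      simp [hx', he', ht.not_gt, (show ¬ t + 1 < T by omega), h₁, pow_succ']
  have hbound : ∀ j, 0 < j → c * ∑ t ∈ Finset.range T, x t ⬝ᵥ x t
      ≤ C * ((x 0 - M ^ j *ᵥ x T) ⬝ᵥ (x 0 - M ^ j *ᵥ x T)) := by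
    intro j hj
    have h₁ := sum_supply_add_le hcC hrec (N := T + j) (by omega)
    have h₂ : x' (T + j) = M ^ j *ᵥ x T := by simp [hx']
    rw [h₂, hx'T 0 (Nat.zero_le _), Finset.sum_range_add, Finset.sum_range_add] at h₁
    have h₃ : ∑ t ∈ Finset.range T, x' t ⬝ᵥ x' t = ∑ t ∈ Finset.range T, x t ⬝ᵥ x t :=
      Finset.sum_congr rfl fun t ht => by rw [hx'T t (Finset.mem_range.1 ht).le]
    have h₄ : 0 ≤ ∑ t ∈ Finset.range T,
        supply P X Y ((1 - A - F) *ᵥ x' t - F *ᵥ e' t) (e' t) := by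
      refine (sum_supply_delayOp_nonneg hh hs hX hY y T).trans_eq
        (Finset.sum_congr rfl fun t ht => ?_)
      have ht' := Finset.mem_range.1 ht
      rw [hx'T t ht'.le, ← htr.feedback t]
      simp only [he', if_pos ht']
      rw [htr.output t]
    have h₅ : 0 ≤ ∑ i ∈ Finset.range j,
        supply P X Y ((1 - A - F) *ᵥ x' (T + i) - F *ᵥ e' (T + i)) (e' (T + i)) := by
      refine Finset.sum_nonneg fun i _ => ?_
      have : e' (T + i) = 0 := by simp [he']
      rw [this]
      simpa [supply] using hP.dotProduct_mulVec_nonneg ((1 - A - F) *ᵥ x' (T + i))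
    have h₆ : 0 ≤ ∑ i ∈ Finset.range j, x' (T + i) ⬝ᵥ x' (T + i) :=
      Finset.sum_nonneg fun i _ => by simpa using dotProduct_star_self_nonneg (x' (T + i))
    have h₇ := mul_nonneg hc.le h₆
    rw [h₃] at h₁
    linarith
  have hlim : Filter.Tendsto
      (fun j : ℕ => C * ((x 0 - M ^ j *ᵥ x T) ⬝ᵥ (x 0 - M ^ j *ᵥ x T))) Filter.atTop
      (nhds (C * (x 0 ⬝ᵥ x 0))) := by
    have hcont : Continuous fun v : Fin n → ℝ => C * ((x 0 - v) ⬝ᵥ (x 0 - v)) := by fun_prop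
    simpa [Function.comp_def] using (hcont.tendsto 0).comp (hSchur.tendsto_pow_mulVec (x T))
  have hle := ge_of_tendsto hlim ((Filter.eventually_gt_atTop 0).mono hbound)
  rw [div_mul_eq_mul_div, le_div_iff₀ hc]
  linarith

theorem norm2_sq {n : ℕ} (v : Fin n → ℝ) : norm2 v ^ 2 = v ⬝ᵥ v := by
  rw [norm2, EuclideanSpace.norm_sq_eq]
  simp [dotProduct, sq]

end AperiodicSampling

theorem corollary2 {n m : ℕ} (A : Matrix (Fin n) (Fin n) ℝ) (B : Matrix (Fin n) (Fin m) ℝ)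
    (K : Matrix (Fin m) (Fin n) ℝ) (h : ℕ) (hh : 1 ≤ h)
    (hSchur : AperiodicSampling.IsSchur (A + B * K))
    (hfreq : ∃ X Y : Matrix (Fin n) (Fin n) ℝ, X.PosDef ∧ Y.PosSemidef ∧
      ∀ ω : ℝ, |ω| ≤ Real.pi →
        AperiodicSampling.NegDef
          (Matrix.conjTranspose
              (AperiodicSampling.stackG A B K (Complex.exp (Complex.I * (ω : ℂ)))) *
            AperiodicSampling.toC (AperiodicSampling.multiplier h X Y) *
            AperiodicSampling.stackG A B K (Complex.exp (Complex.I * (ω : ℂ))))) :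
    AperiodicSampling.AsymptoticallyStable A B K h := by
  obtain ⟨X, Y, hX, hY, hXY⟩ := hfreq
  obtain ⟨γ, hγ, hsum⟩ :=
    AperiodicSampling.exists_sum_sq_le A B K h hh hSchur hX.posSemidef hY hXY
  simp only [← AperiodicSampling.norm2_sq] at hsum
  constructor
  · intro ε hε
    refine ⟨ε / (γ + 1), by positivity, fun s hs x y e htr hx₀ t => ?_⟩
    have h₁ := hsum s hs x y e htr (t + 1)
    have h₂ : AperiodicSampling.norm2 (x t) ^ 2
        ≤ ∑ i ∈ Finset.range (t + 1), AperiodicSampling.norm2 (x i) ^ 2 :=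
      Finset.single_le_sum (f := fun i => AperiodicSampling.norm2 (x i) ^ 2)
        (fun _ _ => sq_nonneg _) (Finset.self_mem_range_succ t)
    have h₀ : 0 ≤ AperiodicSampling.norm2 (x 0) := norm_nonneg _
    have h₃ : (γ + 1) * AperiodicSampling.norm2 (x 0) < ε := by
      rw [lt_div_iff₀ (by positivity)] at hx₀
      linarith
    refine lt_of_le_of_lt (abs_le_of_sq_le_sq' ?_ (by positivity)).2 h₃
    refine (h₂.trans h₁).trans ?_
    rw [mul_pow]
    gcongr
    nlinarith
  · intro s hs x y e htr
    have h₁ : Summable fun t => AperiodicSampling.norm2 (x t) ^ 2 :=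
      summable_of_sum_range_le (fun _ => sq_nonneg _) (hsum s hs x y e htr)
    have h₂ := h₁.tendsto_atTop_zero.sqrt
    simpa [Real.sqrt_sq, AperiodicSampling.norm2] using h₂
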